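/- Let $\mathcal L$ be a complex Lie algebra of finite dimension $n\ge 3$, with basis $x_1,\dots,x_n$. Let $$Q_{\mathcal L}(z)=\det\bigl(z_0I+z_1\,\mathrm{ad}\,x_1+\cdots+z_n\,\mathrm{ad}\,x_n\bigr)\in\mathbb C[z_0,z_1,\dots,z_n]$$ be its characteristic polynomial with respect to this basis. It is divisible by $z_0$; put $Q^*_{\mathcal L}(z)=Q_{\mathcal L}(z)/z_0$. If $Q^*_{\mathcal L}$ is irreducible in $\mathbb C[z_0,\dots,z_n]$, then $\mathcal L$ is simple, i.e. $\mathcal L$ is non-abelian and its only ideals are $0$ and $\mathcal L$. -/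

import Mathlib

noncomputable section

namespace LieCharPoly

open MvPolynomial

/-- The linear pencil `z₀ I + z₁ T₁ + ⋯ + zₙ Tₙ`, where `Tᵢ` is the matrix of `ad xᵢ` in the basis
`x₁, …, xₙ`. The variable `z₀` is `X 0` and the variable attached to `b i` is `X i.succ`. -/
def adPencil {K L : Type*} [Field K] [LieRing L] [LieAlgebra K L] {n : ℕ}
    (b : Module.Basis (Fin n) K L) : Matrix (Fin n) (Fin n) (MvPolynomial (Fin (n + 1)) K) :=
  (X 0 : MvPolynomial (Fin (n + 1)) K) • 1 +
    ∑ i : Fin n, (X i.succ : MvPolynomial (Fin (n + 1)) K) •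
      (LinearMap.toMatrix b b (LieAlgebra.ad K L (b i))).map C

/-- The characteristic polynomial `Q_L(z) = det (z₀ I + z₁ ad x₁ + ⋯ + zₙ ad xₙ)` of `L` with
respect to the basis `x₁, …, xₙ`. -/
def Q {K L : Type*} [Field K] [LieRing L] [LieAlgebra K L] {n : ℕ}
    (b : Module.Basis (Fin n) K L) : MvPolynomial (Fin (n + 1)) K :=
  (adPencil b).det

/-- The polynomial `Q*_L(z) = Q_L(z) / z₀`; the division is exact as soon as `L ≠ 0`,
see `X_zero_mul_QStar`. -/
def QStar {K L : Type*} [Field K] [LieRing L] [LieAlgebra K L] {n : ℕ}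
    (b : Module.Basis (Fin n) K L) : MvPolynomial (Fin (n + 1)) K :=
  (Q b).divMonomial (Finsupp.single 0 1)

/-- The generic element `z₁ x₁ + ⋯ + zₙ xₙ` lies in the kernel of `z₁ ad x₁ + ⋯ + zₙ ad xₙ`. -/
theorem adPencil_mulVec {K L : Type*} [Field K] [LieRing L] [LieAlgebra K L] {n : ℕ}
    (b : Module.Basis (Fin n) K L) :
    (adPencil b).mulVec (fun i => X i.succ) =
      (X 0 : MvPolynomial (Fin (n + 1)) K) • (fun i => X i.succ) := by
  have key : ∀ k, ∑ i : Fin n, ∑ j : Fin n, (X i.succ : MvPolynomial (Fin (n + 1)) K) *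
      (C (b.repr ⁅b i, b j⁆ k) * X j.succ) = 0 := by
    intro k
    rw [← Finset.sum_product']
    refine Finset.sum_involution (fun p _ => (p.2, p.1)) ?_ ?_ ?_ ?_
    · rintro ⟨i, j⟩ -
      simp only
      rw [← lie_skew (b i) (b j)]
      simp only [map_neg, Finsupp.neg_apply]
      ring
    · rintro ⟨i, j⟩ - h h'
      obtain rfl : j = i := congrArg Prod.fst h'
      simp at h
    · simp
    · simp
  rw [adPencil, Matrix.add_mulVec, Matrix.smul_mulVec, Matrix.one_mulVec, Matrix.sum_mulVec,
    add_eq_left]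
  ext1 k
  rw [Finset.sum_apply]
  refine Eq.trans (Finset.sum_congr rfl fun i _ => ?_) (key k)
  rw [Matrix.smul_mulVec, Pi.smul_apply, smul_eq_mul, Matrix.mulVec, dotProduct, Finset.mul_sum]
  refine Finset.sum_congr rfl fun j _ => ?_
  rw [Matrix.map_apply, LinearMap.toMatrix_apply, LieAlgebra.ad_apply]

/-- `z₀` divides the characteristic polynomial of a nonzero Lie algebra, so that `QStar` is the
exact quotient. -/
theorem X_zero_mul_QStar {K L : Type*} [Field K] [LieRing L] [LieAlgebra K L] {n : ℕ}
    (hn : 0 < n) (b : Module.Basis (Fin n) K L) : X 0 * QStar b = Q b := by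
  have h : (X 0 : MvPolynomial (Fin (n + 1)) K) ∣ Q b * X (Fin.succ ⟨0, hn⟩) := by
    have h1 := congrArg (fun v => (adPencil b).adjugate.mulVec v ⟨0, hn⟩) (adPencil_mulVec b)
    simp only [Matrix.mulVec_mulVec, Matrix.adjugate_mul, Matrix.smul_mulVec, Matrix.one_mulVec,
      Matrix.mulVec_smul, Pi.smul_apply, smul_eq_mul] at h1
    exact ⟨_, h1⟩
  have hd : (X 0 : MvPolynomial (Fin (n + 1)) K) ∣ Q b := by
    refine ((X_prime (R := K) (i := (0 : Fin (n + 1)))).dvd_or_dvd h).resolve_right ?_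
    rw [X_dvd_X]
    simp [Fin.ext_iff]
  obtain ⟨q, hq⟩ := hd
  rw [QStar, hq]
  congr 1
  exact X_mul_divMonomial 0 q

end LieCharPoly

end

/-! In a basis adapted to a proper nonzero ideal `I`, the pencil is block triangular, so `Q` is the
product of the determinants on `I` and on `L/I`. The generic element of `L/I` commutes with itself,
so `z₀` divides the second factor, and `Q*` splits accordingly. Irreducibility then forces `dim L/I
= 1` (`finrank_add_one_of_irreducible`). Such ideals cannot exist in a non-abelian algebra of
dimension at least 3: complementary ideals, or a line inside an abelian ideal, would give dimension
2 (`isSimple_of_forall_finrank_add_one`). -/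

noncomputable section

namespace LieCharPoly

open MvPolynomial Module

section Field

variable {K L : Type*} [Field K] [LieRing L] [LieAlgebra K L] {n : ℕ}

/-- The pencil `z₀ I + z₁ ad x₁ + ⋯ + zₙ ad xₙ` attached to the basis `b = (x₁, …, xₙ)`, with the
endomorphisms `ad xᵢ` written in a second basis `c`. -/
def pencilIn {ι : Type*} [Fintype ι] [DecidableEq ι] (b : Basis (Fin n) K L) (c : Basis ι K L) :
    Matrix ι ι (MvPolynomial (Fin (n + 1)) K) :=
  (X 0 : MvPolynomial (Fin (n + 1)) K) • 1 +
    ∑ i : Fin n, (X i.succ : MvPolynomial (Fin (n + 1)) K) •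
      (LinearMap.toMatrix c c (LieAlgebra.ad K L (b i))).map C

/-- The change of basis matrix from `b` to `c`, with constant polynomial entries. -/
def baseChange {ι κ : Type*} (n : ℕ) (b : Basis κ K L) (c : Basis ι K L) :
    Matrix ι κ (MvPolynomial (Fin (n + 1)) K) :=
  (c.toMatrix b).map C

theorem baseChange_mul_baseChange {ι κ : Type*} [Fintype κ] [DecidableEq ι]
    (b : Basis κ K L) (c : Basis ι K L) : baseChange n b c * baseChange n c b = 1 := by
  rw [baseChange, baseChange, ← Matrix.map_mul, Basis.toMatrix_mul_toMatrix_flip,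
    Matrix.map_one _ C_0 C_1]

theorem pencilIn_eq_conj {ι : Type*} [Fintype ι] [DecidableEq ι] (b : Basis (Fin n) K L)
    (c : Basis ι K L) : pencilIn b c = baseChange n b c * adPencil b * baseChange n c b := by
  rw [adPencil, Matrix.mul_add, Matrix.add_mul, Matrix.mul_smul, Matrix.mul_one, Matrix.smul_mul,
    baseChange_mul_baseChange, Matrix.mul_sum, Matrix.sum_mul, pencilIn]
  congr 1
  refine Finset.sum_congr rfl fun i _ => ?_
  rw [Matrix.mul_smul, Matrix.smul_mul, baseChange, baseChange, ← Matrix.map_mul,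
    ← Matrix.map_mul, basis_toMatrix_mul_linearMap_toMatrix_mul_basis_toMatrix]

theorem det_pencilIn {ι : Type*} [Fintype ι] [DecidableEq ι] (b : Basis (Fin n) K L)
    (c : Basis ι K L) : (pencilIn b c).det = Q b := by
  rw [pencilIn_eq_conj, Matrix.det_conj_of_mul_eq_one (baseChange_mul_baseChange b c)
    (baseChange_mul_baseChange c b), Q]

/-- The coordinates in the basis `c` of the generic element `z₁ x₁ + ⋯ + zₙ xₙ`. -/
def genericCoord {ι : Type*} (b : Basis (Fin n) K L) (c : Basis ι K L) :
    ι → MvPolynomial (Fin (n + 1)) K :=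
  (baseChange n b c).mulVec fun i => X i.succ

theorem pencilIn_mulVec_genericCoord {ι : Type*} [Fintype ι] [DecidableEq ι]
    (b : Basis (Fin n) K L) (c : Basis ι K L) :
    (pencilIn b c).mulVec (genericCoord b c) =
      (X 0 : MvPolynomial (Fin (n + 1)) K) • genericCoord b c := by
  rw [pencilIn_eq_conj, genericCoord, Matrix.mulVec_mulVec, Matrix.mul_assoc,
    baseChange_mul_baseChange, Matrix.mul_one, ← Matrix.mulVec_mulVec, adPencil_mulVec,
    Matrix.mulVec_smul]

/-- At `z₀ = 0` and `zᵢ` the `b`-coordinates of `c j`, the generic element becomes `c j`, whose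
`j`-th coordinate is 1. -/
theorem not_X_zero_dvd_genericCoord {ι : Type*} (b : Basis (Fin n) K L) (c : Basis ι K L) (j : ι) :
    ¬ (X 0 : MvPolynomial (Fin (n + 1)) K) ∣ genericCoord b c j := by
  classical
  rintro ⟨q, hq⟩
  have h := congrArg (eval (Fin.cons 0 fun i => b.repr (c j) i)) hq
  have h1 : ∑ i, c.repr (b i) j * b.repr (c j) i = 1 := by
    have h2 := congrFun (congrFun (c.toMatrix_mul_toMatrix_flip b) j) j
    simpa only [Matrix.mul_apply, Basis.toMatrix_apply, Matrix.one_apply_eq] using h2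
  simp [genericCoord, baseChange, Matrix.mulVec, dotProduct, Basis.toMatrix_apply, h1] at h

/-- The specialization `z₀ ↦ t`, `z₁, …, zₙ ↦ 0`. -/
abbrev evalZero (n : ℕ) (t : K) : MvPolynomial (Fin (n + 1)) K →+* K :=
  eval (Fin.cons t 0)

theorem map_evalZero_pencilIn {ι : Type*} [Fintype ι] [DecidableEq ι] (b : Basis (Fin n) K L)
    (c : Basis ι K L) (t : K) : (pencilIn b c).map (evalZero n t) = t • 1 := by
  ext i j
  by_cases hij : i = j <;> simp [pencilIn, Matrix.sum_apply, hij]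

theorem evalZero_det_submatrix {ι κ : Type*} [Fintype ι] [DecidableEq ι] [Fintype κ]
    [DecidableEq κ] (b : Basis (Fin n) K L) (c : Basis ι K L) {f : κ → ι}
    (hf : Function.Injective f) (t : K) :
    evalZero n t ((pencilIn b c).submatrix f f).det = t ^ Fintype.card κ := by
  rw [RingHom.map_det, RingHom.mapMatrix_apply, ← Matrix.submatrix_map, map_evalZero_pencilIn,
    Matrix.submatrix_smul, Pi.smul_apply, Pi.smul_apply, Matrix.submatrix_one f hf, Matrix.det_smul, Matrix.det_one, mul_one]

theorem evalZero_Q (b : Basis (Fin n) K L) (t : K) : evalZero n t (Q b) = t ^ n := by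
  simpa [det_pencilIn] using evalZero_det_submatrix b b Function.injective_id t

/-- A polynomial in `z` that specializes to `t ^ m` at `z₀ = t` and is a unit has `m = 0`. -/
theorem eq_zero_of_isUnit [CharZero K] {p : MvPolynomial (Fin (n + 1)) K} (hp : IsUnit p) {m : ℕ}
    (h : ∀ t, evalZero n t p = t ^ m) : m = 0 := by
  obtain ⟨r, -, rfl⟩ := isUnit_iff_eq_C_of_isReduced.mp hp
  have h1 := h 1
  have h2 := h 2
  rw [eval_C] at h1 h2
  rw [one_pow] at h1
  rw [h1] at h2
  have h3 : (2 ^ m : ℕ) = 1 := by exact_mod_cast h2.symm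
  simpa using h3

/-- If `QStar b` is irreducible over a field of characteristic zero, then every proper nonzero
ideal of `L` has codimension one. -/
theorem finrank_add_one_of_irreducible [CharZero K] (hn : 0 < n) (b : Basis (Fin n) K L)
    (hirr : Irreducible (QStar b)) (I : LieIdeal K L) (hbot : I ≠ ⊥) (htop : I ≠ ⊤) :
    finrank K I + 1 = n := by
  have : Module.Finite K L := .of_basis b
  have hnL : finrank K L = n := by simpa using finrank_eq_card_basis b
  let W : Submodule K L := I.toSubmodule
  have hsum : finrank K (L ⧸ W) + finrank K W = n := hnL ▸ W.finrank_quotient_add_finrank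
  have hW : 0 < finrank K W := by
    rw [Nat.pos_iff_ne_zero, Ne, Submodule.finrank_eq_zero]
    simpa [W] using hbot
  have hQ : 0 < finrank K (L ⧸ W) := by
    have : Nontrivial (L ⧸ W) := Submodule.Quotient.nontrivial_iff.2 (by simpa [W] using htop)
    exact finrank_pos
  let c := (finBasis K W).sumQuot (finBasis K (L ⧸ W))
  let M := pencilIn b c
  have hzero : M.toBlocks₂₁ = 0 := by
    ext1 j i
    have h (k : Fin n) : c.repr ⁅b k, (finBasis K W i : L)⁆ (Sum.inr j) = 0 := by
      have : ⁅b k, (finBasis K W i : L)⁆ ∈ W := I.lie_mem (finBasis K W i).2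
      rw [Basis.sumQuot_repr_inr, Submodule.mkQ_apply, (Submodule.Quotient.mk_eq_zero W).2 this]
      simp
    have h' (k : Fin n) : c.repr ⁅b k, c (Sum.inl i)⁆ (Sum.inr j) = 0 := by
      rw [Basis.sumQuot_inl]; exact h k
    simp [M, Matrix.toBlocks₂₁, pencilIn, Matrix.sum_apply, LinearMap.toMatrix_apply, h']
  have hdet : M.toBlocks₁₁.det * M.toBlocks₂₂.det = Q b := by
    rw [← det_pencilIn b c, ← Matrix.det_fromBlocks_zero₂₁ _ M.toBlocks₁₂, ← hzero,
      Matrix.fromBlocks_toBlocks]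
  have hvec : M.toBlocks₂₂.mulVec (genericCoord b c ∘ Sum.inr) =
      (X 0 : MvPolynomial (Fin (n + 1)) K) • (genericCoord b c ∘ Sum.inr) := by
    have h := pencilIn_mulVec_genericCoord b c
    change M.mulVec _ = _ at h
    rw [← Matrix.fromBlocks_toBlocks M, hzero, Matrix.fromBlocks_mulVec, Matrix.zero_mulVec,
      zero_add] at h
    ext1 j
    exact congrFun h (Sum.inr j)
  -- Multiplying `hvec` by the adjugate gives `det • v = z₀ • adj v`, and the prime `z₀` divides no
  -- entry of `v`.
  have hdvd : (X 0 : MvPolynomial (Fin (n + 1)) K) ∣ M.toBlocks₂₂.det := by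
    have h := congrArg (fun v => M.toBlocks₂₂.adjugate.mulVec v ⟨0, hQ⟩) hvec
    simp only [Matrix.mulVec_mulVec, Matrix.adjugate_mul, Matrix.smul_mulVec, Matrix.one_mulVec,
      Matrix.mulVec_smul, Pi.smul_apply, smul_eq_mul] at h
    exact ((X_prime (R := K) (i := (0 : Fin (n + 1)))).dvd_or_dvd ⟨_, h⟩).resolve_right
      (not_X_zero_dvd_genericCoord b c _)
  obtain ⟨R, hR⟩ := hdvd
  have hfac : QStar b = M.toBlocks₁₁.det * R := by
    refine mul_left_cancel₀ (X_ne_zero (R := K) (0 : Fin (n + 1))) ?_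
    rw [X_zero_mul_QStar hn, ← hdet, hR]
    ring
  have hev₁ (t : K) : evalZero n t M.toBlocks₁₁.det = t ^ finrank K W := by
    exact (evalZero_det_submatrix b c Sum.inl_injective t).trans (by rw [Fintype.card_fin])
  have hev₂ (t : K) : evalZero n t M.toBlocks₂₂.det = t ^ finrank K (L ⧸ W) := by
    exact (evalZero_det_submatrix b c Sum.inr_injective t).trans (by rw [Fintype.card_fin])
  obtain h | h := hirr.isUnit_or_isUnit hfac
  · have := eq_zero_of_isUnit h hev₁
    omega
  -- With `R = r` constant, `t * r = t ^ dim L/I`; `t = 1` gives `r = 1`, and `t = 2` gives the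
  -- dimension.
  · obtain ⟨r, -, rfl⟩ := isUnit_iff_eq_C_of_isReduced.mp h
    have h1 := hev₂ 1
    have h2 := hev₂ 2
    rw [hR, map_mul, eval_X, eval_C, Fin.cons_zero] at h1 h2
    rw [one_pow, one_mul] at h1
    rw [h1, mul_one] at h2
    have h3 : (2 ^ 1 : ℕ) = 2 ^ finrank K (L ⧸ W) := by exact_mod_cast (pow_one 2).trans h2
    have h4 := Nat.pow_right_injective le_rfl h3
    change finrank K W + 1 = n
    omega

theorem not_isLieAbelian_of_irreducible (hn : 3 ≤ n) (b : Basis (Fin n) K L)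
    (hirr : Irreducible (QStar b)) : ¬ IsLieAbelian L := by
  intro hab
  have hQ : Q b = X 0 ^ n := by
    have : adPencil b = (X 0 : MvPolynomial (Fin (n + 1)) K) • 1 := by
      ext1 i j
      simp [adPencil, Matrix.sum_apply, LinearMap.toMatrix_apply, hab.trivial]
    rw [Q, this, Matrix.det_smul, Matrix.det_one, mul_one, Fintype.card_fin]
  -- Here `Q* = z₀ ^ (n - 1)`, and both factors are non-units since `n - 2 ≥ 1`.
  have h : QStar b = X 0 * X 0 ^ (n - 2) := by
    refine mul_left_cancel₀ (X_ne_zero (R := K) (0 : Fin (n + 1))) ?_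
    rw [X_zero_mul_QStar (by omega), hQ, ← pow_succ', ← pow_succ']
    congr 1
    omega
  have hX : ¬ IsUnit (X 0 : MvPolynomial (Fin (n + 1)) K) := X_prime.not_isUnit
  obtain h | h := hirr.isUnit_or_isUnit h
  · exact hX h
  · exact hX ((isUnit_pow_iff (by omega)).mp h)

end Field

/-- Over an algebraically closed field of characteristic zero, a non-abelian Lie algebra of
dimension at least three in which all proper nonzero ideals have codimension one is simple. -/
theorem isSimple_of_forall_finrank_add_one {K L : Type*} [Field K] [IsAlgClosed K] [CharZero K]
    [LieRing L] [LieAlgebra K L] [Module.Finite K L] (hdim : 3 ≤ finrank K L)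
    (hab : ¬ IsLieAbelian L)
    (h : ∀ I : LieIdeal K L, I ≠ ⊥ → I ≠ ⊤ → finrank K I + 1 = finrank K L) :
    LieAlgebra.IsSimple K L := by
  refine ⟨fun I => ?_, hab⟩
  by_contra! hI
  obtain ⟨hbot, htop⟩ := hI
  by_cases hrad : LieAlgebra.HasTrivialRadical K L
  -- In the semisimple case ideals have complements; two of codimension one give `2 * (n - 1) = n`.
  · obtain ⟨J, hJ⟩ := exists_isCompl I
    have hI := h I hbot htop
    have hJ' := h J (by rintro rfl; exact htop (by simpa using hJ.sup_eq_top))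
      (by rintro rfl; exact hbot (by simpa using hJ.inf_eq_bot))
    have hd : IsCompl I.toSubmodule J.toSubmodule := by
      rwa [LieSubmodule.isCompl_toSubmodule]
    have := Submodule.finrank_add_eq_of_isCompl hd
    change finrank K I + finrank K J = _ at this
    omega
  · rw [LieAlgebra.hasTrivialRadical_iff_no_abelian_ideals] at hrad
    push Not at hrad
    obtain ⟨J, hJab, hJbot⟩ := hrad
    have hJtop : J ≠ ⊤ := by
      rintro rfl
      exact hab ((lie_abelian_iff_equiv_lie_abelian LieIdeal.topEquiv).mp hJab)
    have hJ := h J hJbot hJtop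
    obtain ⟨x, hx⟩ : ∃ x, x ∉ J := by
      by_contra! hx
      exact hJtop (by ext y; simp [hx y])
    have : Nontrivial J := (LieSubmodule.nontrivial_iff_ne_bot K L L).mpr hJbot
    obtain ⟨μ, hμ⟩ := Module.End.exists_eigenvalue (LieModule.toEnd K L J x)
    obtain ⟨y, hy, hy0⟩ := hμ.exists_hasEigenvector
    rw [Module.End.mem_eigenspace_iff] at hy
    have hxy : ⁅x, (y : L)⁆ = μ • (y : L) := by simpa using congrArg Subtype.val hy
    have hJy (z : L) (hz : z ∈ J) : ⁅z, (y : L)⁆ = 0 := by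
      have := hJab.trivial ⟨z, hz⟩ y
      simpa using congrArg Subtype.val this
    have hspan : Submodule.span K {x} ⊔ J.toSubmodule = ⊤ := by
      refine Submodule.eq_top_of_finrank_eq (le_antisymm (Submodule.finrank_le _) ?_)
      have hlt : J.toSubmodule < Submodule.span K {x} ⊔ J.toSubmodule := by
        refine lt_of_le_of_ne le_sup_right fun he => hx ?_
        change x ∈ J.toSubmodule
        rw [he]
        exact Submodule.mem_sup_left (Submodule.mem_span_singleton_self x)
      have := Submodule.finrank_lt_finrank_of_lt hlt
      change finrank K J < _ at this
      omega
    -- The line through `y` is an ideal: `x` scales `y`, the abelian `J` kills it, and `x` and `J`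
    -- span `L`.
    let N : LieIdeal K L :=
      { Submodule.span K {(y : L)} with
        lie_mem := by
          intro z w hw
          obtain ⟨s, rfl⟩ := Submodule.mem_span_singleton.mp hw
          obtain ⟨t, u, hu, rfl⟩ := LieSubmodule.exists_smul_add_of_span_sup_eq_top hspan z
          refine Submodule.mem_span_singleton.mpr ⟨s * (t * μ), ?_⟩
          simp [hxy, hJy u hu, smul_smul] }
    have hyL : (y : L) ≠ 0 := by simpa using hy0
    have hN1 : finrank K N = 1 := finrank_span_singleton hyL
    have hN := h N
      (fun hN => by
        have : (y : L) ∈ N := Submodule.mem_span_singleton_self (y : L)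
        rw [hN] at this
        exact hyL (by simpa using this))
      (fun hN => by
        have h3 : finrank K (⊤ : LieIdeal K L) = finrank K L := finrank_top K L
        rw [← hN] at h3
        omega)
    omega

end LieCharPoly

end

theorem mainTheorem4 {L : Type*} [LieRing L] [LieAlgebra ℂ L] {n : ℕ} (hn : 3 ≤ n)
    (b : Module.Basis (Fin n) ℂ L) (hirr : Irreducible (LieCharPoly.QStar b)) :
    LieAlgebra.IsSimple ℂ L := by
  have : Module.Finite ℂ L := .of_basis b
  have hdim : Module.finrank ℂ L = n := by simpa using Module.finrank_eq_card_basis b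
  exact LieCharPoly.isSimple_of_forall_finrank_add_one (hdim ▸ hn)
    (LieCharPoly.not_isLieAbelian_of_irreducible hn b hirr) fun I hbot htop =>
      hdim ▸ LieCharPoly.finrank_add_one_of_irreducible (by omega) b hirr I hbot htop
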